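/- Let $n\ge 1$ be an integer and let $p$ be a real number with $1<p<\infty$. For $k\ge 0$ let $L^p\Omega^k(\mathbb{R}^n)$ be the Banach space of (real) $L^p$ differential $k$-forms on Euclidean space $\mathbb{R}^n$, and let $\Omega^{k,p}(\mathbb{R}^n)$ be the subspace of those $\beta\in L^p\Omega^k(\mathbb{R}^n)$ whose exterior differential $d\beta$, in the sense of distributions, belongs to $L^p\Omega^{k+1}(\mathbb{R}^n)$. For $k\ge 1$ the $L^p$ torsion of $\mathbb{R}^n$ in degree $k$ is the quotient vector space $$T^{k,p}(\mathbb{R}^n)=\overline{d\,\Omega^{k-1,p}(\mathbb{R}^n)}\,/\,d\,\Omega^{k-1,p}(\mathbb{R}^n),$$ where the closure is taken in $L^p\Omega^k(\mathbb{R}^n)$. Then $T^{k,p}(\mathbb{R}^n)\neq 0$ for every $k=1,\dots,n$. -/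

import Mathlib

open MeasureTheory
open scoped ENNReal ContDiff

/-- `ℝⁿ` with its Euclidean metric. -/
abbrev Euc (n : ℕ) : Type := EuclideanSpace ℝ (Fin n)

/-- Alternating `k`-linear forms on `ℝⁿ`. -/
abbrev AltForm (n k : ℕ) : Type := Euc n [⋀^Fin k]→L[ℝ] ℝ

/-- The Banach space of `L^p` differential `k`-forms on `ℝⁿ` (modulo equality almost everywhere).
Pointwise norms of forms are operator norms; all norms on the finite-dimensional space
of alternating forms are equivalent. -/
abbrev LpForm (n k : ℕ) (p : ℝ≥0∞) : Type := Lp (AltForm n k) p (volume : Measure (Euc n))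

/-- The exterior product `ℓ ∧ α` of a linear form `ℓ` and an alternating `k`-form `α`:
`(ℓ ∧ α)(v₀, …, v_k) = ∑ i, (-1)^i ℓ(v_i) α(v₀, …, v̂_i, …, v_k)`. -/
noncomputable def wedgeOne {n k : ℕ} (l : Euc n →L[ℝ] ℝ) (a : AltForm n k) : AltForm n (k + 1) :=
  ContinuousAlternatingMap.alternatizeUncurryFin (l.smulRight a)

/-- The formula stated in the doc comment of `wedgeOne`. -/
theorem wedgeOne_apply {n k : ℕ} (l : Euc n →L[ℝ] ℝ) (a : AltForm n k) (v : Fin (k + 1) → Euc n) :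
    wedgeOne l a v = ∑ i : Fin (k + 1), (-1 : ℝ) ^ (i : ℕ) * (l (v i) * a (i.removeNth v)) := by
  simp [wedgeOne, ContinuousAlternatingMap.alternatizeUncurryFin_apply]

theorem wedgeOne_add {n k : ℕ} (l : Euc n →L[ℝ] ℝ) (a b : AltForm n k) :
    wedgeOne l (a + b) = wedgeOne l a + wedgeOne l b := by
  ext v
  simp only [wedgeOne_apply, ContinuousAlternatingMap.add_apply, mul_add, Finset.sum_add_distrib]

theorem wedgeOne_smul {n k : ℕ} (l : Euc n →L[ℝ] ℝ) (c : ℝ) (a : AltForm n k) :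
    wedgeOne l (c • a) = c • wedgeOne l a := by
  ext v
  simp only [wedgeOne_apply, ContinuousAlternatingMap.smul_apply, smul_eq_mul, Finset.mul_sum]
  exact Finset.sum_congr rfl fun i _ => by ring

theorem norm_wedgeOne_le {n k : ℕ} (l : Euc n →L[ℝ] ℝ) (a : AltForm n k) :
    ‖wedgeOne l a‖ ≤ (k + 1) * (‖l‖ * ‖a‖) := by
  have h := ContinuousAlternatingMap.norm_alternatizeUncurryFin_le (l.smulRight a)
  rwa [ContinuousLinearMap.norm_smulRight_apply] at h

theorem continuous_wedgeOne {n k : ℕ} :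
    Continuous fun q : (Euc n →L[ℝ] ℝ) × AltForm n k => wedgeOne q.1 q.2 := by
  have h : Continuous fun q : (Euc n →L[ℝ] ℝ) × AltForm n k => q.1.smulRight q.2 :=
    (ContinuousLinearMap.smulRightL ℝ (Euc n) (AltForm n k)).continuous₂
  exact (ContinuousAlternatingMap.alternatizeUncurryFinCLM ℝ (Euc n) ℝ).continuous.comp h

theorem integrable_wedgeOne {n k : ℕ} {p : ℝ≥0∞} [Fact (1 ≤ p)] (b : LpForm n k p)
    {f : Euc n → ℝ} (hf : ContDiff ℝ ∞ f) (hc : HasCompactSupport f) :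
    Integrable (fun x => wedgeOne (fderiv ℝ f x) (b x)) volume := by
  have hb : LocallyIntegrable (fun x => b x) (volume : Measure (Euc n)) :=
    (Lp.memLp b).locallyIntegrable Fact.out
  have hg : Continuous (fderiv ℝ f) := hf.continuous_fderiv (by simp)
  have h1 : Integrable (fun x => ‖fderiv ℝ f x‖ • b x) (volume : Measure (Euc n)) :=
    hb.integrable_smul_left_of_hasCompactSupport hg.norm (hc.fderiv ℝ).norm
  refine (h1.norm.const_mul ((k : ℝ) + 1)).mono' ?_ (Filter.Eventually.of_forall fun x => ?_)
  · exact continuous_wedgeOne.comp_aestronglyMeasurable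
      (hg.aestronglyMeasurable.prodMk hb.aestronglyMeasurable)
  · simpa [norm_smul] using norm_wedgeOne_le (fderiv ℝ f x) (b x)

theorem integrable_test_smul {n k : ℕ} {p : ℝ≥0∞} [Fact (1 ≤ p)] (b : LpForm n k p)
    {f : Euc n → ℝ} (hf : ContDiff ℝ ∞ f) (hc : HasCompactSupport f) :
    Integrable (fun x => f x • b x) volume :=
  ((Lp.memLp b).locallyIntegrable Fact.out).integrable_smul_left_of_hasCompactSupport
    hf.continuous hc

/-- `η = dβ` in the sense of distributions: `∫ f η = - ∫ df ∧ β` for every smooth compactly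
supported function `f` on `ℝⁿ`. -/
def IsWeakExtDeriv {n k : ℕ} {p : ℝ≥0∞} (b : LpForm n k p) (e : LpForm n (k + 1) p) : Prop :=
  ∀ f : Euc n → ℝ, ContDiff ℝ ∞ f → HasCompactSupport f →
    ∫ x, f x • e x = -∫ x, wedgeOne (fderiv ℝ f x) (b x)

theorem IsWeakExtDeriv.zero {n k : ℕ} {p : ℝ≥0∞} :
    IsWeakExtDeriv (0 : LpForm n k p) (0 : LpForm n (k + 1) p) := by
  intro f _ _
  have h1 : ∫ x, f x • (0 : LpForm n (k + 1) p) x = 0 := by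
    refine integral_eq_zero_of_ae ?_
    filter_upwards [Lp.coeFn_zero (AltForm n (k + 1)) p (volume : Measure (Euc n))] with x hx
    rw [hx, Pi.zero_apply, smul_zero]
  have h2 : ∫ x, wedgeOne (fderiv ℝ f x) ((0 : LpForm n k p) x) = 0 := by
    refine integral_eq_zero_of_ae ?_
    filter_upwards [Lp.coeFn_zero (AltForm n k) p (volume : Measure (Euc n))] with x hx
    have := wedgeOne_smul (fderiv ℝ f x) 0 (0 : AltForm n k)
    simpa [hx] using this
  rw [h1, h2, neg_zero]

theorem IsWeakExtDeriv.add {n k : ℕ} {p : ℝ≥0∞} [Fact (1 ≤ p)] {b b' : LpForm n k p}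
    {e e' : LpForm n (k + 1) p} (h : IsWeakExtDeriv b e) (h' : IsWeakExtDeriv b' e') :
    IsWeakExtDeriv (b + b') (e + e') := by
  intro f hf hc
  have h1 : ∫ x, f x • (e + e') x = ∫ x, (f x • e x + f x • e' x) := by
    refine integral_congr_ae ?_
    filter_upwards [Lp.coeFn_add e e'] with x hx
    rw [hx, Pi.add_apply, smul_add]
  have h2 : ∫ x, wedgeOne (fderiv ℝ f x) ((b + b') x) =
      ∫ x, (wedgeOne (fderiv ℝ f x) (b x) + wedgeOne (fderiv ℝ f x) (b' x)) := by
    refine integral_congr_ae ?_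
    filter_upwards [Lp.coeFn_add b b'] with x hx
    rw [hx, Pi.add_apply, wedgeOne_add]
  rw [h1, h2, integral_add (integrable_test_smul e hf hc) (integrable_test_smul e' hf hc),
    integral_add (integrable_wedgeOne b hf hc) (integrable_wedgeOne b' hf hc),
    h f hf hc, h' f hf hc, neg_add]

theorem IsWeakExtDeriv.smul {n k : ℕ} {p : ℝ≥0∞} {b : LpForm n k p}
    {e : LpForm n (k + 1) p} (c : ℝ) (h : IsWeakExtDeriv b e) :
    IsWeakExtDeriv (c • b) (c • e) := by
  intro f hf hc
  have h1 : ∫ x, f x • (c • e) x = ∫ x, c • (f x • e x) := by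
    refine integral_congr_ae ?_
    filter_upwards [Lp.coeFn_smul c e] with x hx
    rw [hx, Pi.smul_apply, smul_comm]
  have h2 : ∫ x, wedgeOne (fderiv ℝ f x) ((c • b) x) =
      ∫ x, c • wedgeOne (fderiv ℝ f x) (b x) := by
    refine integral_congr_ae ?_
    filter_upwards [Lp.coeFn_smul c b] with x hx
    rw [hx, Pi.smul_apply, wedgeOne_smul]
  rw [h1, h2, integral_smul, integral_smul, h f hf hc, smul_neg]

/-- The image in degree `k` of the exterior differential of the complex `Ω^{*,p}(ℝⁿ)`, where
`Ω^{k,p}(ℝⁿ)` consists of the `L^p` forms of degree `k` whose distributional exterior derivative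
is in `L^p`. It is zero in degree `0`. -/
noncomputable def exactLpForms (n : ℕ) (p : ℝ≥0∞) [Fact (1 ≤ p)] :
    (k : ℕ) → Submodule ℝ (LpForm n k p)
  | 0 => ⊥
  | k + 1 =>
    { carrier := {e | ∃ b : LpForm n k p, IsWeakExtDeriv b e}
      zero_mem' := ⟨0, .zero⟩
      add_mem' := fun ⟨b, hb⟩ ⟨b', hb'⟩ => ⟨b + b', hb.add hb'⟩
      smul_mem' := fun c _ ⟨b, hb⟩ => ⟨c • b, hb.smul c⟩ }

/-- The `L^p` torsion `T^{k,p}(ℝⁿ)`: the closure of the image of `d`, modulo the image of `d`. -/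
abbrev LpTorsion (n k : ℕ) (p : ℝ≥0∞) [Fact (1 ≤ p)] : Type :=
  (exactLpForms n p k).topologicalClosure ⧸
    (exactLpForms n p k).submoduleOf (exactLpForms n p k).topologicalClosure

/-! The proof is by scaling. If the exact forms were closed, the open mapping theorem would give
every exact `e` a primitive of norm at most `C * ‖e‖` (`exists_primitive_norm_le_of_isClosed`).
Dilating coefficients by `r` scales the norms in all degrees by the same constant
(`exists_norm_dilate`), while `d` gains a factor `r` (`IsWeakExtDeriv.smul_dilate`). Dilating `e`,
solving and dilating back yields primitives of `e` of norm at most `r * C * ‖e‖` for every `r > 0`.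
As `r → 0`, closedness of the graph of `d` forces `e = 0`, yet nonzero exact forms exist in degrees
`1, …, n`. -/

/-! ### The weak exterior derivative is a closed operator. -/

/-- The exterior product with linear forms, as a continuous bilinear map. -/
noncomputable def wedgeOneCLM (n k : ℕ) :
    (Euc n →L[ℝ] ℝ) →L[ℝ] AltForm n k →L[ℝ] AltForm n (k + 1) :=
  (ContinuousLinearMap.compL ℝ (AltForm n k) (Euc n →L[ℝ] AltForm n k) (AltForm n (k + 1))
    (ContinuousAlternatingMap.alternatizeUncurryFinCLM ℝ (Euc n) ℝ)).comp
      (ContinuousLinearMap.smulRightL ℝ (Euc n) (AltForm n k))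

@[simp]
theorem wedgeOneCLM_apply {n k : ℕ} (l : Euc n →L[ℝ] ℝ) (a : AltForm n k) :
    wedgeOneCLM n k l a = wedgeOne l a := rfl

/-- Pairing `L^p` functions with a fixed compactly supported continuous function is continuous. -/
theorem continuous_integral_bilin_of_hasCompactSupport {n : ℕ} {E F G : Type*}
    [NormedAddCommGroup E] [NormedSpace ℝ E] [NormedAddCommGroup F] [NormedSpace ℝ F]
    [NormedAddCommGroup G] [NormedSpace ℝ G] [CompleteSpace G]
    {p : ℝ≥0∞} [Fact (1 ≤ p)] (B : E →L[ℝ] F →L[ℝ] G) {g : Euc n → E} (hg : Continuous g)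
    (hc : HasCompactSupport g) :
    Continuous fun b : Lp F p (volume : Measure (Euc n)) => ∫ x, B (g x) (b x) := by
  have : Fact (1 ≤ p.conjExponent) := ⟨le_self_add⟩
  have hm : MemLp g p.conjExponent (volume : Measure (Euc n)) :=
    hg.memLp_of_hasCompactSupport hc
  have : p.conjExponent.HolderConjugate p := ENNReal.HolderConjugate.symm
  refine (B.lpPairing volume p.conjExponent p (hm.toLp g)).continuous.congr fun b => ?_
  rw [ContinuousLinearMap.lpPairing_eq_integral]
  refine integral_congr_ae ?_
  filter_upwards [hm.coeFn_toLp] with x hx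
  rw [hx]

/-- The graph of the weak exterior derivative on `L^p` forms. -/
def weakExtDerivGraph (n k : ℕ) (p : ℝ≥0∞) [Fact (1 ≤ p)] :
    Submodule ℝ (LpForm n k p × LpForm n (k + 1) p) where
  carrier := {q | IsWeakExtDeriv q.1 q.2}
  zero_mem' := .zero
  add_mem' := fun h h' => h.add h'
  smul_mem' := fun c _ h => h.smul c

/-- Each test function imposes one equation whose two sides are continuous in the `L^p` norm. -/
theorem isClosed_weakExtDerivGraph (n k : ℕ) (p : ℝ≥0∞) [Fact (1 ≤ p)] :
    IsClosed (weakExtDerivGraph n k p : Set (LpForm n k p × LpForm n (k + 1) p)) := by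
  have h : (weakExtDerivGraph n k p : Set (LpForm n k p × LpForm n (k + 1) p)) =
      ⋂ (f : Euc n → ℝ) (_ : ContDiff ℝ ∞ f) (_ : HasCompactSupport f),
        {q | ∫ x, f x • q.2 x = -∫ x, wedgeOne (fderiv ℝ f x) (q.1 x)} := by
    ext q
    simp only [Set.mem_iInter]
    rfl
  rw [h]
  refine isClosed_iInter fun f => isClosed_iInter fun hf => isClosed_iInter fun hc => ?_
  refine isClosed_eq ?_ (Continuous.neg ?_)
  · exact (continuous_integral_bilin_of_hasCompactSupport
      (ContinuousLinearMap.lsmul ℝ ℝ) hf.continuous hc).comp continuous_snd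
  · exact (continuous_integral_bilin_of_hasCompactSupport
      (wedgeOneCLM n k) (hf.continuous_fderiv (by simp)) (hc.fderiv ℝ)).comp continuous_fst

theorem IsWeakExtDeriv.eq_zero {n k : ℕ} {p : ℝ≥0∞} [Fact (1 ≤ p)] {e : LpForm n (k + 1) p}
    (h : IsWeakExtDeriv (0 : LpForm n k p) e) : e = 0 := by
  rw [Lp.eq_zero_iff_ae_eq_zero]
  refine ae_eq_zero_of_integral_contDiff_smul_eq_zero
    ((Lp.memLp e).locallyIntegrable Fact.out) fun f hf hc => ?_
  rw [h f hf hc, ← (IsWeakExtDeriv.zero (n := n) (k := k) (p := p)) f hf hc]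
  refine integral_eq_zero_of_ae ?_
  filter_upwards [Lp.coeFn_zero (AltForm n (k + 1)) p (volume : Measure (Euc n))] with x hx
  rw [hx, Pi.zero_apply, smul_zero]

/-! ### Dilations. -/

theorem memLp_comp_const_smul {n : ℕ} {F : Type*} [NormedAddCommGroup F] {p : ℝ≥0∞} {r : ℝ}
    (hr : r ≠ 0) {b : Euc n → F} (hb : MemLp b p volume) :
    MemLp (fun x => b (r • x)) p volume := by
  have hm : MemLp b p (Measure.map (r • ·) (volume : Measure (Euc n))) := by
    rw [Measure.map_addHaar_smul _ hr]
    exact hb.smul_measure ENNReal.ofReal_ne_top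
  exact hm.comp_of_map (measurable_const_smul r).aemeasurable

/-- Precomposition of `L^p` forms (as vector-valued functions) with the homothety `x ↦ r x`. -/
noncomputable def dilate {n k : ℕ} {p : ℝ≥0∞} {r : ℝ} (hr : r ≠ 0) (b : LpForm n k p) :
    LpForm n k p :=
  (memLp_comp_const_smul hr (Lp.memLp b)).toLp _

theorem coeFn_dilate {n k : ℕ} {p : ℝ≥0∞} {r : ℝ} (hr : r ≠ 0) (b : LpForm n k p) :
    dilate hr b =ᵐ[volume] fun x => b (r • x) :=
  MemLp.coeFn_toLp _

theorem dilate_dilate_inv {n k : ℕ} {p : ℝ≥0∞} {r : ℝ} (hr : r ≠ 0) (b : LpForm n k p) :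
    dilate (inv_ne_zero hr) (dilate hr b) = b := by
  refine Lp.ext ?_
  filter_upwards [coeFn_dilate (inv_ne_zero hr) (dilate hr b),
    (Measure.quasiMeasurePreserving_smul (volume : Measure (Euc n)) (inv_ne_zero hr)).ae
      (coeFn_dilate hr b)] with x h1 h2
  rw [h1, h2, smul_inv_smul₀ hr]

/-- Dilations multiply the `L^p` norms by a constant that does not depend on the degree. -/
theorem exists_norm_dilate (n : ℕ) (p : ℝ≥0∞) {r : ℝ} (hr : r ≠ 0) :
    ∃ c : ℝ, 0 ≤ c ∧ ∀ (k : ℕ) (b : LpForm n k p), ‖dilate hr b‖ = c * ‖b‖ := by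
  -- This is `|r| ^ (-n / p)`, read as `1` when `p = ∞`.
  refine ⟨(ENNReal.ofReal |(r ^ Module.finrank ℝ (Euc n))⁻¹| ^ (1 / p).toReal).toReal,
    ENNReal.toReal_nonneg, fun k b => ?_⟩
  have hs : ENNReal.ofReal |(r ^ Module.finrank ℝ (Euc n))⁻¹| ≠ 0 := by
    simp only [ne_eq, ENNReal.ofReal_eq_zero, not_le, abs_pos]
    exact inv_ne_zero (pow_ne_zero _ hr)
  have hm : AEStronglyMeasurable b (Measure.map (r • ·) (volume : Measure (Euc n))) := by
    rw [Measure.map_addHaar_smul _ hr]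
    exact (Lp.aestronglyMeasurable b).mono_ac Measure.smul_absolutelyContinuous
  have h := eLpNorm_map_measure (p := p) hm (measurable_const_smul r).aemeasurable
  rw [Measure.map_addHaar_smul _ hr, eLpNorm_smul_measure_of_ne_zero hs, smul_eq_mul] at h
  rw [dilate, Lp.norm_toLp, Lp.norm_def, ← ENNReal.toReal_mul, h]
  rfl

/-- Test the hypothesis against `f (r⁻¹ • ·)` and change variables: the Jacobians on the two sides
agree, and the chain rule produces the factor `r⁻¹`. -/
theorem IsWeakExtDeriv.smul_dilate {n k : ℕ} {p : ℝ≥0∞} {b : LpForm n k p} {e : LpForm n (k + 1) p}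
    (h : IsWeakExtDeriv b e) {r : ℝ} (hr : r ≠ 0) :
    IsWeakExtDeriv (r⁻¹ • dilate hr b) (dilate hr e) := by
  intro f hf hc
  have hfr : ContDiff ℝ ∞ fun y => f (r⁻¹ • y) := hf.comp (contDiff_const_smul _)
  have hd : ∀ y, fderiv ℝ (fun y => f (r⁻¹ • y)) y = r⁻¹ • fderiv ℝ f (r⁻¹ • y) := fun y =>
    fderiv_comp_smul (f := f) (x := y) (c := r⁻¹)
  have key := h _ hfr (hc.comp_smul (inv_ne_zero hr))
  have h1 : ∫ x, f x • dilate hr e x = ∫ x, (fun y => f (r⁻¹ • y) • e y) (r • x) := by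
    refine integral_congr_ae ?_
    filter_upwards [coeFn_dilate hr e] with x hx
    rw [hx, inv_smul_smul₀ hr]
  have h2 : ∫ x, wedgeOne (fderiv ℝ f x) ((r⁻¹ • dilate hr b : LpForm n k p) x) =
      ∫ x, (fun y => wedgeOne (fderiv ℝ (fun y => f (r⁻¹ • y)) y) (b y)) (r • x) := by
    refine integral_congr_ae ?_
    filter_upwards [coeFn_dilate hr b, Lp.coeFn_smul r⁻¹ (dilate hr b)] with x hx hx'
    simp only [hx', Pi.smul_apply, hx, hd, inv_smul_smul₀ hr, ← wedgeOneCLM_apply, map_smul,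
      smul_apply]
  rw [h1, h2, Measure.integral_comp_smul volume (fun y => f (r⁻¹ • y) • e y), key, smul_neg,
    Measure.integral_comp_smul volume
      (fun y => wedgeOne (fderiv ℝ (fun y => f (r⁻¹ • y)) y) (b y))]

/-! ### Nonzero exact forms. -/

theorem integral_fderiv_eq_zero {n : ℕ} {g : Euc n → ℝ} (hg : ContDiff ℝ 1 g)
    (hc : HasCompactSupport g) : ∫ x, fderiv ℝ g x = 0 := by
  have hd : Continuous (fderiv ℝ g) := hg.continuous_fderiv one_ne_zero
  have hi : Integrable (fderiv ℝ g) := hd.integrable_of_hasCompactSupport (hc.fderiv ℝ)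
  ext v
  -- Integration by parts against the constant function `1`.
  have h := integral_mul_fderiv_eq_neg_fderiv_mul_of_integrable (𝕜 := ℝ)
    (μ := (volume : Measure (Euc n))) (f := fun _ => (1 : ℝ)) (g := g) (v := v)
    (by simp) (by simpa using hi.apply_continuousLinearMap v)
    (by simpa using hg.continuous.integrable_of_hasCompactSupport hc)
    (fun x _ => differentiableAt_const _) (fun x _ => (hg.differentiable one_ne_zero) x)
  rw [ContinuousLinearMap.integral_apply hi]
  simpa using h

/-- `d(f a) = df ∧ a` for a smooth compactly supported function `f` and a constant form `a`. -/
theorem isWeakExtDeriv_smul_const {n k : ℕ} {p : ℝ≥0∞} {f : Euc n → ℝ}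
    (hf : ContDiff ℝ ∞ f) (hc : HasCompactSupport f) (a : AltForm n k) {b : LpForm n k p}
    {e : LpForm n (k + 1) p} (hb : b =ᵐ[volume] fun x => f x • a)
    (he : e =ᵐ[volume] fun x => wedgeOne (fderiv ℝ f x) a) : IsWeakExtDeriv b e := by
  intro g hg hgc
  have hd : Continuous (fderiv ℝ f) := hf.continuous_fderiv (by simp)
  have hgd : Continuous (fderiv ℝ g) := hg.continuous_fderiv (by simp)
  let W : (Euc n →L[ℝ] ℝ) →L[ℝ] AltForm n (k + 1) := (wedgeOneCLM n k).flip a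
  have hW : ∀ l, W l = wedgeOne l a := fun _ => rfl
  have hif : Integrable fun x => f x • fderiv ℝ g x :=
    (hf.continuous.smul hgd).integrable_of_hasCompactSupport hc.smul_right
  have hig : Integrable fun x => g x • fderiv ℝ f x :=
    (hg.continuous.smul hd).integrable_of_hasCompactSupport hgc.smul_right
  have h1 : ∫ x, g x • e x = W (∫ x, g x • fderiv ℝ f x) := by
    rw [← W.integral_comp_comm hig]
    refine integral_congr_ae ?_
    filter_upwards [he] with x hx
    rw [hx, map_smul, hW]
  have h2 : ∫ x, wedgeOne (fderiv ℝ g x) (b x) = W (∫ x, f x • fderiv ℝ g x) := by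
    rw [← W.integral_comp_comm hif]
    refine integral_congr_ae ?_
    filter_upwards [hb] with x hx
    rw [hx, map_smul, hW, ← wedgeOneCLM_apply, map_smul, wedgeOneCLM_apply]
  rw [h1, h2, ← map_neg, eq_comm, ← sub_eq_zero, ← map_sub, ← neg_add',
    ← integral_add hif hig]
  have h3 : ∀ x, f x • fderiv ℝ g x + g x • fderiv ℝ f x = fderiv ℝ (f * g) x := fun x =>
    (fderiv_mul (hf.differentiable (by simp) x) (hg.differentiable (by simp) x)).symm
  simp_rw [h3]
  rw [integral_fderiv_eq_zero (g := f * g) ((hf.mul hg).of_le (by simp)) hc.mul_right, neg_zero, map_zero]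

/-- In degrees `m < n` some constant `m`-form has a nonzero product with a linear form. -/
theorem exists_wedgeOne_proj_ne_zero {n m : ℕ} (hm : m < n) :
    ∃ (l : Euc n →L[ℝ] ℝ) (a : AltForm n m), wedgeOne l a ≠ 0 := by
  -- With coordinates numbered from `0`, the witnesses are `dx₀` and `a = dx₁ ∧ … ∧ dx_m`, evaluated
  -- on the basis vectors `e₀, …, e_m`.
  let ι : Fin (m + 1) → Fin n := Fin.castLE hm
  let P : Euc n →ₗ[ℝ] (Fin m → ℝ) :=
    LinearMap.pi fun j => (EuclideanSpace.proj (𝕜 := ℝ) (ι j.succ) : Euc n →L[ℝ] ℝ)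
  let a : AltForm n m :=
    { (Matrix.detRowAlternating (R := ℝ) (n := Fin m)).compLinearMap P with
      cont := Continuous.matrix_det (A := fun v : Fin m → Euc n => Matrix.of fun i => P (v i))
        (by
          refine continuous_matrix fun i j => ?_
          exact (EuclideanSpace.proj (𝕜 := ℝ) (ι j.succ)).continuous.comp (continuous_apply i)) }
  have ha : ∀ v, a v = Matrix.det (Matrix.of fun i => P (v i)) := fun _ => rfl
  refine ⟨EuclideanSpace.proj (ι 0), a, fun h => ?_⟩
  have h0 := congrArg (fun w : AltForm n (m + 1) =>
    w fun i => EuclideanSpace.single (ι i) (1 : ℝ)) h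
  simp only [wedgeOne_apply] at h0
  -- Only the term `i = 0` survives, since `dx₀` kills the other basis vectors.
  rw [Fin.sum_univ_succ, Finset.sum_eq_zero] at h0
  · have hone : (Matrix.of fun i : Fin m => P ((Fin.removeNth 0
        fun i : Fin (m + 1) => EuclideanSpace.single (ι i) (1 : ℝ)) i)) = 1 := by
      ext i j
      simp [P, ι, Fin.removeNth, Matrix.one_apply, eq_comm]
    rw [ha, hone] at h0
    simp at h0
  · intro i _
    simp [ι, Fin.ext_iff]

theorem exists_isWeakExtDeriv_ne_zero {n m : ℕ} (hm : m < n) (p : ℝ≥0∞) :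
    ∃ (b : LpForm n m p) (e : LpForm n (m + 1) p), IsWeakExtDeriv b e ∧ e ≠ 0 := by
  obtain ⟨l, a, hla⟩ := exists_wedgeOne_proj_ne_zero hm
  -- The bump is `1` near the origin, so the continuous form `d(φ l) ∧ a` takes the value `l ∧ a ≠
  -- 0` there.
  let φ : ContDiffBump (0 : Euc n) := default
  let f : Euc n → ℝ := fun x => φ x * l x
  have hf : ContDiff ℝ ∞ f := φ.contDiff.mul l.contDiff
  have hc : HasCompactSupport f := φ.hasCompactSupport.mul_right
  have hd : Continuous (fderiv ℝ f) := hf.continuous_fderiv (by simp)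
  have hf0 : fderiv ℝ f 0 = l := by
    have : f =ᶠ[nhds 0] l := by
      filter_upwards [φ.eventuallyEq_one] with x hx
      simp [f, hx]
    rw [this.fderiv_eq, l.fderiv]
  have hwc : Continuous fun x => wedgeOne (fderiv ℝ f x) a :=
    ((wedgeOneCLM n m).flip a).continuous.comp hd
  have hws : HasCompactSupport fun x => wedgeOne (fderiv ℝ f x) a :=
    (hc.fderiv ℝ).comp_left (g := (wedgeOneCLM n m).flip a) (map_zero _)
  have hb : MemLp (fun x => f x • a) p (volume : Measure (Euc n)) :=
    (hf.continuous.smul continuous_const).memLp_of_hasCompactSupport hc.smul_right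
  have he : MemLp (fun x => wedgeOne (fderiv ℝ f x) a) p (volume : Measure (Euc n)) :=
    hwc.memLp_of_hasCompactSupport hws
  refine ⟨hb.toLp _, he.toLp _,
    isWeakExtDeriv_smul_const hf hc a hb.coeFn_toLp he.coeFn_toLp, fun h => hla ?_⟩
  have h0 : (fun x => wedgeOne (fderiv ℝ f x) a) =ᵐ[volume] fun _ => 0 :=
    he.coeFn_toLp.symm.trans ((Lp.eq_zero_iff_ae_eq_zero).1 h)
  have h1 := congrFun (hwc.ae_eq_iff_eq volume continuous_const |>.1 h0) 0
  rwa [hf0] at h1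

/-! ### Open mapping and the scaling contradiction. -/

/-- If the exact `L^p` forms are closed, they have primitives of comparable norm. -/
theorem exists_primitive_norm_le_of_isClosed {n k : ℕ} {p : ℝ≥0∞} [Fact (1 ≤ p)]
    (hcl : IsClosed (exactLpForms n p (k + 1) : Set (LpForm n (k + 1) p))) :
    ∃ C : ℝ, ∀ e ∈ exactLpForms n p (k + 1),
      ∃ b : LpForm n k p, IsWeakExtDeriv b e ∧ ‖b‖ ≤ C * ‖e‖ := by
  have : CompleteSpace (exactLpForms n p (k + 1)) := hcl.completeSpace_coe
  have : CompleteSpace (weakExtDerivGraph n k p) :=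
    (isClosed_weakExtDerivGraph n k p).completeSpace_coe
  -- The open mapping theorem is applied to the projection of the graph of `d` onto its image, as
  -- `d` itself is not defined on all of `L^p`.
  let T : weakExtDerivGraph n k p →L[ℝ] exactLpForms n p (k + 1) :=
    ((ContinuousLinearMap.snd ℝ _ _).comp (weakExtDerivGraph n k p).subtypeL).codRestrict _
      fun q => ⟨q.1.1, q.2⟩
  have hT : Function.Surjective T := by
    rintro ⟨e, b, hb⟩
    exact ⟨⟨(b, e), hb⟩, rfl⟩
  obtain ⟨C, -, hC⟩ := T.exists_preimage_norm_le hT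
  refine ⟨C, fun e he => ?_⟩
  obtain ⟨q, hq, hqC⟩ := hC ⟨e, he⟩
  have hqe : q.1.2 = e := congrArg Subtype.val hq
  exact ⟨q.1.1, hqe ▸ q.2, (norm_fst_le q.1).trans hqC⟩

theorem not_isClosed_exactLpForms {n k : ℕ} (hk : k < n) (p : ℝ≥0∞) [Fact (1 ≤ p)] :
    ¬ IsClosed (exactLpForms n p (k + 1) : Set (LpForm n (k + 1) p)) := by
  intro hcl
  obtain ⟨C, hC⟩ := exists_primitive_norm_le_of_isClosed hcl
  obtain ⟨b, e, hbe, he⟩ := exists_isWeakExtDeriv_ne_zero hk p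
  have small : ∀ r : ℝ, 0 < r → ∃ b' : LpForm n k p, IsWeakExtDeriv b' e ∧
      ‖b'‖ ≤ r * (C * ‖e‖) := by
    intro r hr
    obtain ⟨c, -, hc⟩ := exists_norm_dilate n p hr.ne'
    obtain ⟨c', hc'0, hc'⟩ := exists_norm_dilate n p (inv_ne_zero hr.ne')
    -- Solve for the dilated form, then dilate back; the scaling constants `c` and `c'` cancel and
    -- only `r` remains.
    obtain ⟨b₁, hb₁, hn⟩ := hC (dilate hr.ne' e) ⟨_, hbe.smul_dilate hr.ne'⟩
    refine ⟨r • dilate (inv_ne_zero hr.ne') b₁, ?_, ?_⟩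
    · simpa only [inv_inv, dilate_dilate_inv] using hb₁.smul_dilate (inv_ne_zero hr.ne')
    · have hee : ‖e‖ = c' * (c * ‖e‖) := by
        rw [← hc, ← hc', dilate_dilate_inv]
      calc ‖r • dilate (inv_ne_zero hr.ne') b₁‖ = r * (c' * ‖b₁‖) := by
            rw [norm_smul, Real.norm_of_nonneg hr.le, hc']
        _ ≤ r * (c' * (C * (c * ‖e‖))) := by
            rw [← hc]
            gcongr
        _ = r * (C * (c' * (c * ‖e‖))) := by ring
        _ = r * (C * ‖e‖) := by rw [← hee]
  choose! β hβ hβn using small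
  have hr : Filter.Tendsto (fun j : ℕ => 1 / ((j : ℝ) + 1)) Filter.atTop (nhds 0) :=
    tendsto_one_div_add_atTop_nhds_zero_nat
  have hlim : Filter.Tendsto (fun j : ℕ => β (1 / ((j : ℝ) + 1))) Filter.atTop (nhds 0) := by
    refine squeeze_zero_norm (fun j => hβn _ (by positivity)) ?_
    simpa using hr.mul_const (C * ‖e‖)
  exact he (IsWeakExtDeriv.eq_zero ((isClosed_weakExtDerivGraph n k p).mem_of_tendsto
    (hlim.prodMk_nhds tendsto_const_nhds)
    (Filter.Eventually.of_forall fun j : ℕ => hβ (1 / ((j : ℝ) + 1)) (by positivity))))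

theorem mainTheorem11 (n k : ℕ) (hk : 1 ≤ k) (hkn : k ≤ n) (p : ℝ≥0∞) [Fact (1 ≤ p)]
    (hp : 1 < p) (hp' : p ≠ ⊤) : Nontrivial (LpTorsion n k p) := by
  obtain ⟨m, rfl⟩ := Nat.exists_eq_add_of_le' hk
  rw [Submodule.Quotient.nontrivial_iff]
  intro h
  rw [Submodule.submoduleOf_eq_top] at h
  exact not_isClosed_exactLpForms hkn p (closure_subset_iff_isClosed.1 h)
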